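/- Let $M_k$ be the space of complex $k\times k$ matrices with the inner product $\langle C,D\rangle=\operatorname{tr}(CD^*)$, and identify $M_k\otimes M_m$ with $M_{km}$ via the Kronecker product. A Hermitian Schmidt decomposition of a matrix $A\in M_k\otimes M_m$ is an expression $A=\sum_{i=1}^n\lambda_i\,\gamma_i\otimes\delta_i$ with real $\lambda_i>0$ and orthonormal families $(\gamma_i)$ in $M_k$, $(\delta_i)$ in $M_m$ of Hermitian matrices. A positive semidefinite Hermitian matrix $A\in M_k\otimes M_k$ is SPC if it has a Hermitian Schmidt decomposition $\sum_{i=1}^n\lambda_i\,\gamma_i\otimes\gamma_i$. A positive semidefinite Hermitian matrix $A\in M_k\otimes M_m$ is weak irreducible if, whenever $V_1,V_2\in M_k$ and $W_1,W_2\in M_m$ are Hermitian projections with $V_1V_2=0$, $W_1W_2=0$, $V_1+V_2=\mathrm{Id}$, $W_1+W_2=\mathrm{Id}$ and $A=\sum_{i=1}^2(V_i\otimes W_i)A(V_i\otimes W_i)$, one has $(V_1\otimes W_1)A(V_1\otimes W_1)=0$ or $(V_2\otimes W_2)A(V_2\otimes W_2)=0$. The matrix $A$ is separable if $A=\sum_{j=1}^r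 C_j\otimes D_j$ with $C_j\in M_k$ and $D_j\in M_m$ positive semidefinite Hermitian. (1) Let $A\in M_k\otimes M_k$ be a weak irreducible SPC matrix, let $A=\sum_{i=1}^n\lambda_i\,\gamma_i\otimes\gamma_i$ ($n\ge 1$) be a Hermitian Schmidt decomposition with $\lambda_1\ge\dots\ge\lambda_n>0$, and let $\mu$ be the least positive eigenvalue of $\gamma_1\otimes\gamma_1$. If $$\frac{\lambda_1\mu}{\lambda_2+\dots+\lambda_n}\ \ge\ \frac12$$ (a condition regarded as satisfied when $n=1$), then $A$ is separable. (2) The inequality is sharp in $M_2\otimes M_2$ in the following sense. Let $\gamma_1=\frac1{\sqrt2}\mathrm{Id},\gamma_2,\gamma_3,\gamma_4$ be the orthonormal Pauli basis of $M_2$ (the identity and the three Pauli matrices, each divided by $\sqrt2$). The least positive eigenvalue of $\gamma_1\otimes\gamma_1$ is $\mu=\frac12$, and for all $\lambda_1,\lambda_2,\lambda_3,\lambda_4>0$ the expression $A=\sum_{i=1}^4\lambda_i\,\gamma_i\otimes\gamma_i$ is a Hermitian Schmidt decomposition, and $A$ is separable if and only if $$\frac{\lambda_1\mu}{\lambda_2+\lambda_3+\lambda_4}\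 \ge\ \frac12 .$$ -/

import Mathlib

open scoped Kronecker ComplexOrder

namespace Bipartite

/-- A matrix in `M_k ⊗ M_m`, identified through the Kronecker product with a square matrix
indexed by `Fin k × Fin m`. -/
abbrev TMat (k m : ℕ) : Type := Matrix (Fin k × Fin m) (Fin k × Fin m) ℂ

/-- A finite family of matrices that is orthonormal for the inner product
`⟨C, D⟩ = tr (C D*)`. -/
def IsOrthonormalFamily {k n : ℕ} (γ : Fin n → Matrix (Fin k) (Fin k) ℂ) : Prop :=
  ∀ i j, (γ i * (γ j).conjTranspose).trace = if i = j then 1 else 0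

/-- `A = ∑ i, c i • (γ i ⊗ δ i)` is a Hermitian Schmidt decomposition of `A`: the coefficients
are positive reals, and `γ` and `δ` are orthonormal families of Hermitian matrices. -/
structure IsHermitianSchmidt {k m n : ℕ} (A : TMat k m) (c : Fin n → ℝ)
    (γ : Fin n → Matrix (Fin k) (Fin k) ℂ) (δ : Fin n → Matrix (Fin m) (Fin m) ℂ) : Prop where
  coeff_pos : ∀ i, 0 < c i
  left_hermitian : ∀ i, (γ i).IsHermitian
  right_hermitian : ∀ i, (δ i).IsHermitian
  left_orthonormal : IsOrthonormalFamily γ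
  right_orthonormal : IsOrthonormalFamily δ
  eq_sum : A = ∑ i, (c i : ℂ) • (γ i ⊗ₖ δ i)

/-- `A` is symmetric with positive coefficients (SPC): it is positive semidefinite Hermitian and
has a Hermitian Schmidt decomposition `∑ i, c i • (γ i ⊗ γ i)`. -/
def IsSPC {k : ℕ} (A : TMat k k) : Prop :=
  A.PosSemidef ∧
    ∃ (n : ℕ) (c : Fin n → ℝ) (γ : Fin n → Matrix (Fin k) (Fin k) ℂ),
      IsHermitianSchmidt A c γ γ

/-- `A` is weak irreducible: it is positive semidefinite Hermitian, and whenever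
`A = (V₁ ⊗ W₁) A (V₁ ⊗ W₁) + (V₂ ⊗ W₂) A (V₂ ⊗ W₂)` for complementary Hermitian projections
`V₁, V₂` and complementary Hermitian projections `W₁, W₂`, one of the two summands vanishes. -/
def IsWeakIrreducible {k m : ℕ} (A : TMat k m) : Prop :=
  A.PosSemidef ∧
    ∀ (V₁ V₂ : Matrix (Fin k) (Fin k) ℂ) (W₁ W₂ : Matrix (Fin m) (Fin m) ℂ),
      IsStarProjection V₁ → IsStarProjection V₂ → IsStarProjection W₁ → IsStarProjection W₂ →
      V₁ * V₂ = 0 → W₁ * W₂ = 0 → V₁ + V₂ = 1 → W₁ + W₂ = 1 →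
      A = (V₁ ⊗ₖ W₁) * A * (V₁ ⊗ₖ W₁) + (V₂ ⊗ₖ W₂) * A * (V₂ ⊗ₖ W₂) →
      (V₁ ⊗ₖ W₁) * A * (V₁ ⊗ₖ W₁) = 0 ∨ (V₂ ⊗ₖ W₂) * A * (V₂ ⊗ₖ W₂) = 0

/-- `A` is separable: it is a finite sum of tensor products of positive semidefinite Hermitian
matrices. -/
def IsSeparable {k m : ℕ} (A : TMat k m) : Prop :=
  ∃ (n : ℕ) (C : Fin n → Matrix (Fin k) (Fin k) ℂ) (D : Fin n → Matrix (Fin m) (Fin m) ℂ),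
    (∀ i, (C i).PosSemidef) ∧ (∀ i, (D i).PosSemidef) ∧ A = ∑ i, C i ⊗ₖ D i

/-- `μ` is the least positive eigenvalue of the matrix `B`. -/
def IsLeastPosEigenvalue {k m : ℕ} (B : TMat k m) (μ : ℝ) : Prop :=
  IsLeast {x : ℝ | 0 < x ∧ Module.End.HasEigenvalue (Matrix.toLin' B) (x : ℂ)} μ

/-- The orthonormal Pauli basis of `M_2`: the identity and the three Pauli matrices, each divided
by `√2`. -/
noncomputable def normalizedPauli : Fin 4 → Matrix (Fin 2) (Fin 2) ℂ :=
  ![((Real.sqrt 2 : ℝ) : ℂ)⁻¹ • !![1, 0; 0, 1],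
    ((Real.sqrt 2 : ℝ) : ℂ)⁻¹ • !![0, 1; 1, 0],
    ((Real.sqrt 2 : ℝ) : ℂ)⁻¹ • !![0, -Complex.I; Complex.I, 0],
    ((Real.sqrt 2 : ℝ) : ℂ)⁻¹ • !![1, 0; 0, -1]]

/-- The matrix `∑ i, c i • (γ i ⊗ γ i)` in `M_2 ⊗ M_2`, with `γ` the orthonormal Pauli basis. -/
noncomputable def pauliMatrix (c : Fin 4 → ℝ) : TMat 2 2 :=
  ∑ i, (c i : ℂ) • (normalizedPauli i ⊗ₖ normalizedPauli i)

end Bipartite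

namespace Bipartite

open Matrix

/-! ### Separable matrices -/

/-! If `γ` is Hermitian with `tr γ² = 1`, two distinct eigenvalues have product at least `-1/2`, so
`γ ⊗ γ + 1/2 • 1` is separable in its product eigenbasis. Each non-leading term thus costs half a
copy of the identity, which the leading term must supply. It can do so on its support `V`: if the
nonzero eigenvalues of `γ 0` have one sign, `γ 0 ⊗ γ 0 - μ • V ⊗ V` is separable. If moreover every
`γ i` lives on `V`, the costs shrink to copies of `V ⊗ V` and the hypothesis balances the account
(`isSeparable_of_half_sum_le`).

The one sign and the common support come from a Perron–Frobenius argument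
(`conj_support_eq_of_leading`). The form `tr (A (X ⊗ X))` is maximal on the Hermitian unit sphere at
`γ 0`, hence also at `|γ 0|`, so the positive and negative parts of `γ 0` satisfy the same
eigenvector equation. A nonzero positive semidefinite eigenvector splits `A` along its support and
the complement; weak irreducibility kills the complementary block (`conj_support_eq`). So one of the
two parts vanishes.

Sharpness: pairing with the swap, separability forces `tr (contract A) ≤ tr A`, which for the Pauli
matrices is exactly the inequality. -/

lemma isSeparable_zero {k m : ℕ} : IsSeparable (0 : TMat k m) :=
  ⟨0, fun _ => 0, fun _ => 0, fun i => i.elim0, fun i => i.elim0, by simp⟩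

lemma isSeparable_kronecker {k m : ℕ} {C : Matrix (Fin k) (Fin k) ℂ}
    {D : Matrix (Fin m) (Fin m) ℂ} (hC : C.PosSemidef) (hD : D.PosSemidef) :
    IsSeparable (C ⊗ₖ D) :=
  ⟨1, fun _ => C, fun _ => D, fun _ => hC, fun _ => hD, by simp⟩

lemma IsSeparable.add {k m : ℕ} {A B : TMat k m} (hA : IsSeparable A) (hB : IsSeparable B) :
    IsSeparable (A + B) := by
  obtain ⟨n, C, D, hC, hD, rfl⟩ := hA
  obtain ⟨n', C', D', hC', hD', rfl⟩ := hB
  refine ⟨n + n', Fin.append C C', Fin.append D D', fun i => ?_, fun i => ?_, ?_⟩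
  · induction i using Fin.addCases <;> simp [hC, hC']
  · induction i using Fin.addCases <;> simp [hD, hD']
  · simp [Fin.sum_univ_add]

lemma isSeparable_sum {ι : Type*} {k m : ℕ} (s : Finset ι) {A : ι → TMat k m}
    (hA : ∀ i ∈ s, IsSeparable (A i)) : IsSeparable (∑ i ∈ s, A i) :=
  Finset.sum_induction A IsSeparable (fun _ _ => IsSeparable.add) isSeparable_zero hA

lemma IsSeparable.smul {k m : ℕ} {A : TMat k m} (hA : IsSeparable A) {r : ℝ} (hr : 0 ≤ r) :
    IsSeparable ((r : ℂ) • A) := by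
  obtain ⟨n, C, D, hC, hD, rfl⟩ := hA
  refine ⟨n, fun i => (r : ℂ) • C i, D, fun i => (hC i).smul (by exact_mod_cast hr), hD, ?_⟩
  simp [Finset.smul_sum, smul_kronecker]

lemma IsSeparable.conj_kronecker {k m : ℕ} {A : TMat k m} (hA : IsSeparable A)
    (V : Matrix (Fin k) (Fin k) ℂ) (W : Matrix (Fin m) (Fin m) ℂ) :
    IsSeparable ((V ⊗ₖ W) * A * (Vᴴ ⊗ₖ Wᴴ)) := by
  obtain ⟨n, C, D, hC, hD, rfl⟩ := hA
  refine ⟨n, fun i => V * C i * Vᴴ, fun i => W * D i * Wᴴ,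
    fun i => (hC i).mul_mul_conjTranspose_same _, fun i => (hD i).mul_mul_conjTranspose_same _, ?_⟩
  simp [Finset.mul_sum, Finset.sum_mul, mul_kronecker_mul]

/-! ### Functional calculus in a fixed orthonormal basis -/

/-- The matrix with real eigenvalues `f` in the orthonormal basis of columns of `U`. -/
noncomputable def conjDiag {k : ℕ} (U : unitaryGroup (Fin k) ℂ) (f : Fin k → ℝ) :
    Matrix (Fin k) (Fin k) ℂ :=
  (U : Matrix (Fin k) (Fin k) ℂ) * diagonal (fun i => (f i : ℂ)) *
    (U : Matrix (Fin k) (Fin k) ℂ)ᴴ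

section conjDiag

variable {k : ℕ} (U : unitaryGroup (Fin k) ℂ) (f g : Fin k → ℝ)

lemma _root_.Matrix.IsHermitian.exists_eq_conjDiag {γ : Matrix (Fin k) (Fin k) ℂ}
    (h : γ.IsHermitian) : ∃ U f, γ = conjDiag U f :=
  ⟨h.eigenvectorUnitary, h.eigenvalues, by
    simpa [conjDiag, Unitary.conjStarAlgAut_apply, Function.comp_def, star_eq_conjTranspose]
      using h.spectral_theorem⟩

lemma conjDiag_mul : conjDiag U f * conjDiag U g = conjDiag U (f * g) := by
  have hU : (U : Matrix (Fin k) (Fin k) ℂ)ᴴ * (U : Matrix (Fin k) (Fin k) ℂ) = 1 :=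
    UnitaryGroup.star_mul_self U
  calc _ = (U : Matrix (Fin k) (Fin k) ℂ) * diagonal (fun i => (f i : ℂ)) *
      ((U : Matrix (Fin k) (Fin k) ℂ)ᴴ * (U : Matrix (Fin k) (Fin k) ℂ)) *
      diagonal (fun i => (g i : ℂ)) * (U : Matrix (Fin k) (Fin k) ℂ)ᴴ := by
        simp only [conjDiag, Matrix.mul_assoc]
    _ = _ := by
      rw [hU, Matrix.mul_one, Matrix.mul_assoc (U : Matrix (Fin k) (Fin k) ℂ),
        diagonal_mul_diagonal]
      simp [conjDiag]

lemma conjDiag_add : conjDiag U f + conjDiag U g = conjDiag U (f + g) := by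
  have : diagonal (fun i => ((f + g) i : ℂ)) =
      diagonal (fun i => (f i : ℂ)) + diagonal (fun i => (g i : ℂ)) := by
    simp [diagonal_add]
  rw [conjDiag, conjDiag, conjDiag, this, Matrix.mul_add, Matrix.add_mul]

lemma conjDiag_zero : conjDiag U 0 = 0 := by simp [conjDiag]

lemma conjDiag_one : conjDiag U 1 = 1 := by
  have hU : (U : Matrix (Fin k) (Fin k) ℂ) * (U : Matrix (Fin k) (Fin k) ℂ)ᴴ = 1 :=
    (mem_unitaryGroup_iff).1 U.2
  simp [conjDiag, hU]

lemma conjDiag_smul (r : ℝ) : conjDiag U (r • f) = (r : ℂ) • conjDiag U f := by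
  have : diagonal (fun i => ((r • f) i : ℂ)) = (r : ℂ) • diagonal (fun i => (f i : ℂ)) := by
    ext i j; by_cases h : i = j <;> simp [diagonal, h]
  rw [conjDiag, conjDiag, this, Matrix.mul_smul, Matrix.smul_mul]

lemma conjDiag_sum {ι : Type*} (s : Finset ι) (f : ι → Fin k → ℝ) :
    conjDiag U (∑ i ∈ s, f i) = ∑ i ∈ s, conjDiag U (f i) := by
  classical
  induction s using Finset.induction_on with
  | empty => simp [conjDiag_zero]
  | insert a s ha ih => rw [Finset.sum_insert ha, Finset.sum_insert ha, ← conjDiag_add, ih]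

lemma conjDiag_eq_sum :
    conjDiag U f = ∑ i, (f i : ℂ) • conjDiag U (Pi.single i 1) := by
  simp_rw [← conjDiag_smul, ← conjDiag_sum]
  congr 1
  ext j
  simp [Finset.sum_apply, Pi.single_apply]

lemma conjDiag_isHermitian : (conjDiag U f).IsHermitian := by
  have : (diagonal (fun i => (f i : ℂ)))ᴴ = diagonal (fun i => (f i : ℂ)) := by
    simp [diagonal_conjTranspose, Pi.star_def]
  simp [IsHermitian, conjDiag, this, Matrix.mul_assoc]

lemma trace_conjDiag : (conjDiag U f).trace = ((∑ i, f i : ℝ) : ℂ) := by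
  have hU : (U : Matrix (Fin k) (Fin k) ℂ)ᴴ * (U : Matrix (Fin k) (Fin k) ℂ) = 1 :=
    UnitaryGroup.star_mul_self U
  rw [conjDiag, Matrix.mul_assoc, trace_mul_comm, Matrix.mul_assoc, hU, Matrix.mul_one,
    trace_diagonal]
  simp

/-- Pairing with the `j`-th eigenprojection under the trace recovers `f j`. -/
lemma conjDiag_injective : Function.Injective (conjDiag U) := by
  intro f g h
  ext j
  have h2 := congrArg (fun M => (M * conjDiag U (Pi.single j 1)).trace) h
  simp only [conjDiag_mul, trace_conjDiag] at h2
  simpa [Pi.single_apply] using Complex.ofReal_injective h2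

variable {f} in
lemma conjDiag_posSemidef (hf : 0 ≤ f) : (conjDiag U f).PosSemidef := by
  refine PosSemidef.mul_mul_conjTranspose_same (posSemidef_diagonal_iff.2 fun i => ?_) _
  exact_mod_cast hf i

lemma conjDiag_indicator_isStarProjection (p : Fin k → Prop) [DecidablePred p] :
    IsStarProjection (conjDiag U fun i => if p i then 1 else 0) := by
  refine ⟨?_, conjDiag_isHermitian _ _⟩
  rw [IsIdempotentElem, conjDiag_mul]
  congr 1
  ext i
  simp

end conjDiag

/-! ### ### Separability in a product eigenbasis -/

lemma sum_kronecker_sum {ι κ : Type*} [Fintype ι] [Fintype κ] {k m : ℕ}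
    (X : ι → Matrix (Fin k) (Fin k) ℂ) (Y : κ → Matrix (Fin m) (Fin m) ℂ) :
    (∑ i, X i) ⊗ₖ (∑ j, Y j) = ∑ i, ∑ j, X i ⊗ₖ Y j := by
  ext a b
  simp [Matrix.sum_apply, Finset.sum_mul_sum]

lemma conjDiag_kronecker {k m : ℕ} (U : unitaryGroup (Fin k) ℂ) (W : unitaryGroup (Fin m) ℂ)
    (f : Fin k → ℝ) (g : Fin m → ℝ) :
    conjDiag U f ⊗ₖ conjDiag W g = ∑ i, ∑ j, ((f i * g j : ℝ) : ℂ) •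
      (conjDiag U (Pi.single i 1) ⊗ₖ conjDiag W (Pi.single j 1)) := by
  rw [conjDiag_eq_sum U f, conjDiag_eq_sum W g, sum_kronecker_sum]
  refine Finset.sum_congr rfl fun i _ => Finset.sum_congr rfl fun j _ => ?_
  rw [smul_kronecker, kronecker_smul, smul_smul, Complex.ofReal_mul]

/-- A real combination of `conjDiag U f ⊗ conjDiag U f` and `conjDiag U g ⊗ conjDiag U g` is
separable as soon as its coefficients in the product eigenbasis are nonnegative. -/
lemma isSeparable_conjDiag_kronecker_add {k : ℕ} (U : unitaryGroup (Fin k) ℂ)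
    (f g : Fin k → ℝ) (r : ℝ) (h : ∀ i j, 0 ≤ f i * f j + r * (g i * g j)) :
    IsSeparable (conjDiag U f ⊗ₖ conjDiag U f + (r : ℂ) • (conjDiag U g ⊗ₖ conjDiag U g)) := by
  have : conjDiag U f ⊗ₖ conjDiag U f + (r : ℂ) • (conjDiag U g ⊗ₖ conjDiag U g) =
      ∑ i, ∑ j, ((f i * f j + r * (g i * g j) : ℝ) : ℂ) •
      (conjDiag U (Pi.single i 1) ⊗ₖ conjDiag U (Pi.single j 1)) := by
    rw [conjDiag_kronecker, conjDiag_kronecker]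
    simp only [Finset.smul_sum, smul_smul, ← Finset.sum_add_distrib, ← add_smul]
    push_cast
    rfl
  rw [this]
  have hp (i : Fin k) : (0 : Fin k → ℝ) ≤ Pi.single i 1 := by
    simp
  exact isSeparable_sum _ fun i _ => isSeparable_sum _ fun j _ =>
    (isSeparable_kronecker (conjDiag_posSemidef U (hp i))
      (conjDiag_posSemidef U (hp j))).smul (h i j)

/-- The eigenvalues satisfy `∑ f i ^ 2 = 1`, so for `i ≠ j` one has `2 |f i * f j| ≤ f i ^ 2 + f j ^
2 ≤ 1`; for `i = j` the product is a square. -/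
lemma isSeparable_kronecker_self_add_half {k : ℕ} {γ : Matrix (Fin k) (Fin k) ℂ}
    (h : γ.IsHermitian) (h1 : (γ * γ).trace = 1) :
    IsSeparable (γ ⊗ₖ γ + ((1 / 2 : ℝ) : ℂ) • (1 ⊗ₖ 1)) := by
  obtain ⟨U, f, rfl⟩ := h.exists_eq_conjDiag
  rw [conjDiag_mul, trace_conjDiag] at h1
  have h1 : ∑ i, f i * f i = 1 := by exact_mod_cast h1
  rw [← conjDiag_one U]
  refine isSeparable_conjDiag_kronecker_add U f 1 _ fun i j => ?_
  by_cases hij : i = j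
  · subst hij
    have := mul_self_nonneg (f i)
    simp; linarith
  · have := Finset.add_le_sum (f := fun i => f i * f i) (s := Finset.univ)
      (fun i _ => mul_self_nonneg (f i)) (Finset.mem_univ i) (Finset.mem_univ j) hij
    simp only [Pi.one_apply]
    nlinarith [mul_self_nonneg (f i + f j)]

/-! ### Traces of positive semidefinite matrices -/

lemma exists_eq_conjTranspose_mul_self {ι : Type*} [Fintype ι] [DecidableEq ι]
    {C : Matrix ι ι ℂ} (hC : C.PosSemidef) : ∃ S : Matrix ι ι ℂ, C = Sᴴ * S := by
  open scoped MatrixOrder in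
  exact CStarAlgebra.nonneg_iff_eq_star_mul_self.1 (nonneg_iff_posSemidef.2 hC)

lemma trace_mul_eq_of_conjTranspose_mul_self {ι : Type*} [Fintype ι] (S R : Matrix ι ι ℂ) :
    ((Sᴴ * S) * (Rᴴ * R)).trace = ((S * Rᴴ)ᴴ * (S * Rᴴ)).trace := by
  rw [← Matrix.mul_assoc, trace_mul_comm, conjTranspose_mul, conjTranspose_conjTranspose]
  simp only [Matrix.mul_assoc]

lemma trace_mul_nonneg {ι : Type*} [Fintype ι] [DecidableEq ι] {C D : Matrix ι ι ℂ}
    (hC : C.PosSemidef) (hD : D.PosSemidef) : 0 ≤ (C * D).trace := by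
  obtain ⟨S, rfl⟩ := exists_eq_conjTranspose_mul_self hC
  obtain ⟨R, rfl⟩ := exists_eq_conjTranspose_mul_self hD
  rw [trace_mul_eq_of_conjTranspose_mul_self]
  exact (posSemidef_conjTranspose_mul_self _).trace_nonneg

/-- With `C = Sᴴ * S` and `D = Rᴴ * R`, the trace is the squared norm of `S * Rᴴ`. -/
lemma mul_eq_zero_of_trace_mul_eq_zero {ι : Type*} [Fintype ι] [DecidableEq ι]
    {C D : Matrix ι ι ℂ} (hC : C.PosSemidef) (hD : D.PosSemidef) (h : (C * D).trace = 0) :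
    C * D = 0 := by
  obtain ⟨S, rfl⟩ := exists_eq_conjTranspose_mul_self hC
  obtain ⟨R, rfl⟩ := exists_eq_conjTranspose_mul_self hD
  rw [trace_mul_eq_of_conjTranspose_mul_self, trace_conjTranspose_mul_self_eq_zero_iff] at h
  rw [Matrix.mul_assoc, ← Matrix.mul_assoc S, h]
  simp

lemma trace_mul_eq_re {k : ℕ} {X Y : Matrix (Fin k) (Fin k) ℂ} (hX : X.IsHermitian)
    (hY : Y.IsHermitian) : (X * Y).trace = (((X * Y).trace.re : ℝ) : ℂ) := by
  have : star (X * Y).trace = (X * Y).trace := by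
    rw [← trace_conjTranspose, conjTranspose_mul, hX, hY, trace_mul_comm]
  exact (Complex.conj_eq_iff_re.1 this).symm

/-- No eigenvalue of `C` exceeds its trace, so `C.trace • 1 - C` is positive semidefinite and pairs
nonnegatively with `D`. -/
lemma trace_mul_le_trace_mul_trace {k : ℕ} {C D : Matrix (Fin k) (Fin k) ℂ}
    (hC : C.PosSemidef) (hD : D.PosSemidef) : (C * D).trace ≤ C.trace * D.trace := by
  have h : (C.trace • 1 - C).PosSemidef := by
    obtain ⟨U, f, hf⟩ := hC.isHermitian.exists_eq_conjDiag
    have hf0 (i) : 0 ≤ f i := by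
      have := trace_mul_nonneg hC (conjDiag_posSemidef U (f := Pi.single i 1) (by simp))
      rw [hf, conjDiag_mul, trace_conjDiag] at this
      simpa [Pi.single_apply] using this
    have : C.trace • 1 - C = conjDiag U (fun i => ∑ j, f j - f i) := by
      rw [hf, trace_conjDiag, ← conjDiag_one U, ← conjDiag_smul, sub_eq_iff_eq_add, conjDiag_add]
      congr 1
      ext i
      simp
    rw [this]
    exact conjDiag_posSemidef U fun i =>
      sub_nonneg.2 (Finset.single_le_sum (fun j _ => hf0 j) (Finset.mem_univ i))
  have := trace_mul_nonneg h hD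
  rw [Matrix.sub_mul, trace_sub, Matrix.smul_mul, Matrix.one_mul, trace_smul, smul_eq_mul] at this
  exact sub_nonneg.1 this

/-! ### The contraction `X ⊗ Y ↦ X * Y` -/

/-- The linear map with `X ⊗ Y ↦ X * Y`. -/
def contract {k : ℕ} : TMat k k →ₗ[ℂ] Matrix (Fin k) (Fin k) ℂ where
  toFun A := of fun i j => ∑ l, A (i, l) (l, j)
  map_add' A B := by ext; simp [Finset.sum_add_distrib]
  map_smul' r A := by ext; simp [Finset.mul_sum]

lemma contract_kronecker {k : ℕ} (X Y : Matrix (Fin k) (Fin k) ℂ) :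
    contract (X ⊗ₖ Y) = X * Y := by
  ext i j
  simp [contract, Matrix.mul_apply]

/-- Contracting and taking the trace turns the sum into `∑ c i * ‖B i‖²`. This is where positivity
of the Schmidt coefficients enters. -/
lemma eq_zero_of_sum_smul_conjTranspose_kronecker_eq_zero {k n : ℕ} {c : Fin n → ℝ}
    (hc : ∀ i, 0 < c i) (B : Fin n → Matrix (Fin k) (Fin k) ℂ)
    (h : ∑ i, (c i : ℂ) • ((B i)ᴴ ⊗ₖ B i) = 0) (i : Fin n) : B i = 0 := by
  have h2 : ∑ i, (c i : ℂ) * ((B i)ᴴ * B i).trace = 0 := by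
    simpa [map_sum, contract_kronecker, trace_sum, trace_smul] using
      congrArg (fun M => (contract M).trace) h
  have h3 := (Finset.sum_eq_zero_iff_of_nonneg fun i _ =>
    mul_nonneg (Complex.zero_le_real.2 (hc i).le)
      (posSemidef_conjTranspose_mul_self (B i)).trace_nonneg).1 h2 i (Finset.mem_univ i)
  rw [mul_eq_zero, trace_conjTranspose_mul_self_eq_zero_iff] at h3
  exact h3.resolve_left (by exact_mod_cast (hc i).ne')

/-! ### The bilinear form of a symmetric Schmidt decomposition -/

lemma IsHermitianSchmidt.trace_mul_kronecker {k n : ℕ} {A : TMat k k} {c : Fin n → ℝ}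
    {γ : Fin n → Matrix (Fin k) (Fin k) ℂ} (h : IsHermitianSchmidt A c γ γ)
    (X Y : Matrix (Fin k) (Fin k) ℂ) :
    (A * (X ⊗ₖ Y)).trace = ∑ i, (c i : ℂ) * ((γ i * X).trace * (γ i * Y).trace) := by
  rw [h.eq_sum, Finset.sum_mul, trace_sum]
  simp [trace_smul, ← mul_kronecker_mul, trace_kronecker]

lemma IsHermitianSchmidt.conj_kronecker_eq_sum {k n : ℕ} {A : TMat k k} {c : Fin n → ℝ}
    {γ : Fin n → Matrix (Fin k) (Fin k) ℂ} (h : IsHermitianSchmidt A c γ γ)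
    (X Y Z W : Matrix (Fin k) (Fin k) ℂ) :
    (X ⊗ₖ Y) * A * (Z ⊗ₖ W) = ∑ i, (c i : ℂ) • ((X * γ i * Z) ⊗ₖ (Y * γ i * W)) := by
  simp [h.eq_sum, Finset.sum_mul, Finset.mul_sum, mul_kronecker_mul]

lemma IsHermitianSchmidt.trace_mul {k n : ℕ} {A : TMat k k} {c : Fin n → ℝ}
    {γ : Fin n → Matrix (Fin k) (Fin k) ℂ} (h : IsHermitianSchmidt A c γ γ) (i j : Fin n) :
    (γ i * γ j).trace = if i = j then 1 else 0 := by
  rw [← h.left_orthonormal i j, h.left_hermitian j]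

/-- A Hermitian matrix at which the form `X ↦ tr (A (X ⊗ X))` attains its maximum on the unit
sphere is an eigenvector for the largest coefficient. -/
lemma IsHermitianSchmidt.trace_mul_kronecker_of_max {k n : ℕ} {A : TMat k k}
    {c : Fin n → ℝ} {γ : Fin n → Matrix (Fin k) (Fin k) ℂ} (h : IsHermitianSchmidt A c γ γ)
    {m : ℝ} (hm : 0 < m) (hcm : ∀ i, c i ≤ m) {X : Matrix (Fin k) (Fin k) ℂ}
    (hX : X.IsHermitian) (hmax : (m : ℂ) * (X * X).trace ≤ (A * (X ⊗ₖ X)).trace)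
    (Y : Matrix (Fin k) (Fin k) ℂ) : (A * (X ⊗ₖ Y)).trace = m * (X * Y).trace := by
  obtain ⟨t, ht⟩ : ∃ t : Fin n → ℝ, ∀ i, (γ i * X).trace = t i :=
    ⟨fun i => (γ i * X).trace.re, fun i => trace_mul_eq_re (h.left_hermitian i) hX⟩
  obtain ⟨s, hs⟩ : ∃ s : ℝ, (X * X).trace = s := ⟨_, trace_mul_eq_re hX hX⟩
  -- `Q` is the component of `X` orthogonal to the span of the `γ i`. Maximality forces `Q = 0` and
  -- `t i = 0` wherever `c i < m`.
  set Q := X - ∑ i, (t i : ℂ) • γ i with hQ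
  have hQh : Q.IsHermitian := by
    refine hX.sub ?_
    rw [IsHermitian, conjTranspose_sum]
    refine Finset.sum_congr rfl fun i _ => ?_
    rw [conjTranspose_smul, h.left_hermitian i]
    simp
  have hγQ (i) : (γ i * Q).trace = 0 := by
    simp [hQ, Matrix.mul_sub, Finset.mul_sum, trace_sub, trace_sum, ht, h.trace_mul]
  have hXQ : (X * Q).trace = ((s - ∑ i, t i * t i : ℝ) : ℂ) := by
    have ht' (i) : (X * γ i).trace = t i := by rw [trace_mul_comm, ht]
    simp [hQ, Matrix.mul_sub, Finset.mul_sum, trace_sub, trace_sum, ht', hs]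
  have hQQ : (Qᴴ * Q).trace = ((s - ∑ i, t i * t i : ℝ) : ℂ) := by
    rw [hQh, ← hXQ]
    nth_rewrite 1 [hQ]
    simp [Matrix.sub_mul, Finset.sum_mul, trace_sub, trace_sum, hγQ]
  have hnn : 0 ≤ s - ∑ i, t i * t i := by
    have := (posSemidef_conjTranspose_mul_self Q).trace_nonneg
    rw [hQQ] at this
    exact_mod_cast this
  have hmax' : m * s ≤ ∑ i, c i * (t i * t i) := by
    rw [h.trace_mul_kronecker, hs] at hmax
    simp only [ht] at hmax
    exact_mod_cast hmax
  have hterm (i) : 0 ≤ (m - c i) * (t i * t i) :=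
    mul_nonneg (sub_nonneg.2 (hcm i)) (mul_self_nonneg _)
  have hsum : ∑ i, (m - c i) * (t i * t i) = m * ∑ i, t i * t i - ∑ i, c i * (t i * t i) := by
    simp [sub_mul, Finset.sum_sub_distrib, Finset.mul_sum]
  have hsum0 : ∑ i, (m - c i) * (t i * t i) = 0 := by
    refine le_antisymm ?_ (Finset.sum_nonneg fun i _ => hterm i)
    have := mul_nonneg hm.le hnn
    linarith
  have hQ0 : Q = 0 := by
    rw [← trace_conjTranspose_mul_self_eq_zero_iff, hQQ]
    have : m * (s - ∑ i, t i * t i) ≤ m * 0 := by linarith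
    exact_mod_cast le_antisymm (le_of_mul_le_mul_left this hm) hnn
  have hct (i) : c i * t i = m * t i := by
    have := (Finset.sum_eq_zero_iff_of_nonneg fun i _ => hterm i).1 hsum0 i (Finset.mem_univ i)
    rcases mul_eq_zero.1 this with h' | h'
    · rw [sub_eq_zero.1 h']
    · simp [mul_self_eq_zero.1 h']
  have hXe : X = ∑ i, (t i : ℂ) • γ i := sub_eq_zero.1 (hQ.symm.trans hQ0)
  rw [h.trace_mul_kronecker]
  conv_rhs => rw [hXe, Finset.sum_mul, trace_sum, Finset.mul_sum]
  refine Finset.sum_congr rfl fun i _ => ?_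
  rw [ht, Matrix.smul_mul, trace_smul, smul_eq_mul, ← mul_assoc, ← mul_assoc]
  congr 1
  exact_mod_cast hct i

/-- A positive semidefinite eigenvector of a weak irreducible matrix supports the whole Schmidt
decomposition. -/
lemma IsHermitianSchmidt.conj_support_eq {k n : ℕ} {A : TMat k k} {c : Fin n → ℝ}
    {γ : Fin n → Matrix (Fin k) (Fin k) ℂ} (h : IsHermitianSchmidt A c γ γ)
    (hA : IsWeakIrreducible A) {m : ℝ} (hm : 0 < m) (U : unitaryGroup (Fin k) ℂ)
    {f : Fin k → ℝ} (hf : 0 ≤ f) (hf0 : ∃ j, 0 < f j)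
    (heig : ∀ Y : Matrix (Fin k) (Fin k) ℂ,
      (A * (conjDiag U f ⊗ₖ Y)).trace = (m : ℂ) * (conjDiag U f * Y).trace) (i : Fin n) :
    conjDiag U (fun j => if 0 < f j then 1 else 0) * γ i *
      conjDiag U (fun j => if 0 < f j then 1 else 0) = γ i := by
  set P := conjDiag U f with hP
  set V := conjDiag U (fun j => if 0 < f j then 1 else 0) with hV
  set W := conjDiag U (fun j => if ¬ 0 < f j then 1 else 0) with hW
  have hVs : IsStarProjection V := conjDiag_indicator_isStarProjection U _
  have hWs : IsStarProjection W := conjDiag_indicator_isStarProjection U _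
  have hVh : Vᴴ = V := conjDiag_isHermitian U _
  have hWh : Wᴴ = W := conjDiag_isHermitian U _
  have hPp : P.PosSemidef := conjDiag_posSemidef U hf
  have hWp : W.PosSemidef := conjDiag_posSemidef U fun i => by dsimp; split_ifs <;> simp
  have hVW : V * W = 0 := by
    rw [hV, hW, conjDiag_mul, ← conjDiag_zero U]
    congr 1; ext j; by_cases hj : 0 < f j <;> simp [hj]
  have hVW1 : V + W = 1 := by
    rw [hV, hW, conjDiag_add, ← conjDiag_one U]
    congr 1; ext j; by_cases hj : 0 < f j <;> simp [hj]
  have hPW : P * W = 0 := by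
    rw [hP, hW, conjDiag_mul, ← conjDiag_zero U]
    congr 1; ext j
    by_cases hj : 0 < f j
    · simp [hj]
    · simp [le_antisymm (not_lt.1 hj) (hf j)]
  have hVPV : V * P * V = P := by
    rw [hV, hP, conjDiag_mul, conjDiag_mul]
    congr 1; ext j
    by_cases hj : 0 < f j
    · simp [hj]
    · simp [le_antisymm (not_lt.1 hj) (hf j)]
  -- Since `0⁻¹ = 0`, `f⁻¹` gives the pseudo-inverse of `P`, which later replaces `P` by its support
  -- `V`.
  have hPinv : P * conjDiag U f⁻¹ = V := by
    rw [hP, hV, conjDiag_mul]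
    congr 1; ext j
    by_cases hj : 0 < f j
    · simp [hj, hj.ne']
    · simp [le_antisymm (not_lt.1 hj) (hf j)]
  have hAPW : A * (P ⊗ₖ W) = 0 :=
    mul_eq_zero_of_trace_mul_eq_zero hA.1 (hPp.kronecker hWp) (by simp [heig, hPW])
  have hAWP : A * (W ⊗ₖ P) = 0 := by
    refine mul_eq_zero_of_trace_mul_eq_zero hA.1 (hWp.kronecker hPp) ?_
    -- The form is symmetric in its two tensor factors, so this trace equals that of `hAPW`.
    refine Eq.trans ?_ ((congrArg trace hAPW).trans (trace_zero _ _))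
    rw [h.trace_mul_kronecker, h.trace_mul_kronecker]
    simp only [mul_comm (γ _ * W).trace]
  have hAVW : A * (V ⊗ₖ W) = 0 := by
    have := congrArg (· * (conjDiag U f⁻¹ ⊗ₖ (1 : Matrix (Fin k) (Fin k) ℂ))) hAPW
    simpa [Matrix.mul_assoc, ← mul_kronecker_mul, hPinv] using this
  have hAWV : A * (W ⊗ₖ V) = 0 := by
    have := congrArg (· * ((1 : Matrix (Fin k) (Fin k) ℂ) ⊗ₖ conjDiag U f⁻¹)) hAWP
    simpa [Matrix.mul_assoc, ← mul_kronecker_mul, hPinv] using this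
  -- Compressing `A` by `W ⊗ V` on the left and `V ⊗ W` on the right gives zero, and each term has
  -- the shape `Bᴴ ⊗ B` with `B = V * γ i * W`.
  have hVγW (i) : V * γ i * W = 0 := by
    refine eq_zero_of_sum_smul_conjTranspose_kronecker_eq_zero h.coeff_pos
      (fun i => V * γ i * W) ?_ i
    have := h.conj_kronecker_eq_sum W V V W
    rw [Matrix.mul_assoc, hAVW, Matrix.mul_zero] at this
    rw [this]
    refine Finset.sum_congr rfl fun i _ => ?_
    simp only [conjTranspose_mul, hVh, hWh, (h.left_hermitian i).eq, Matrix.mul_assoc]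
  have hWγV (i) : W * γ i * V = 0 := by
    have := congrArg conjTranspose (hVγW i)
    simpa [conjTranspose_mul, hVh, hWh, (h.left_hermitian i).eq, Matrix.mul_assoc] using this
  have hright : A * (V ⊗ₖ V) + A * (W ⊗ₖ W) = A := by
    have h1 : (V + W) ⊗ₖ (V + W) = (1 : TMat k k) := by rw [hVW1, one_kronecker_one]
    have h2 := congrArg (A * ·) h1
    simpa [add_kronecker, kronecker_add, Matrix.mul_add, hAVW, hAWV] using h2
  have hleft : (V ⊗ₖ V) * A + (W ⊗ₖ W) * A = A := by
    have := congrArg conjTranspose hright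
    simpa [conjTranspose_mul, conjTranspose_kronecker, hVh, hWh, hA.1.isHermitian.eq] using this
  have hdec : A = (V ⊗ₖ V) * A * (V ⊗ₖ V) + (W ⊗ₖ W) * A * (W ⊗ₖ W) := by
    have h1 : (V ⊗ₖ V) * A * (W ⊗ₖ W) = 0 := by simp [h.conj_kronecker_eq_sum, hVγW]
    have h2 : (W ⊗ₖ W) * A * (V ⊗ₖ V) = 0 := by simp [h.conj_kronecker_eq_sum, hWγV]
    conv_lhs => rw [← hright, ← hleft]
    simp only [Matrix.add_mul, h1, h2, add_zero, zero_add]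
  have hWγW (i) : W * γ i * W = 0 := by
    rcases hA.2 V W V W hVs hWs hVs hWs hVW hVW hVW1 hVW1 hdec with h0 | h0
    -- The `V` block cannot vanish: `P` lives on `V`, and `tr (A (P ⊗ P)) = m * tr P² > 0`.
    · exfalso
      have h1 : (A * (P ⊗ₖ P)).trace = 0 := by
        have : P ⊗ₖ P = (V ⊗ₖ V) * (P ⊗ₖ P) * (V ⊗ₖ V) := by
          simp [← mul_kronecker_mul, hVPV]
        rw [this, ← Matrix.mul_assoc, trace_mul_comm, ← Matrix.mul_assoc, ← Matrix.mul_assoc, h0,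
          Matrix.zero_mul, trace_zero]
      rw [heig, hP, conjDiag_mul, trace_conjDiag, ← Complex.ofReal_mul,
        Complex.ofReal_eq_zero] at h1
      obtain ⟨j, hj⟩ := hf0
      have : 0 < ∑ i, (f * f) i :=
        Finset.sum_pos' (fun i _ => mul_self_nonneg _) ⟨j, Finset.mem_univ j, mul_pos hj hj⟩
      exact (mul_pos hm this).ne' h1
    · refine eq_zero_of_sum_smul_conjTranspose_kronecker_eq_zero h.coeff_pos
        (fun i => W * γ i * W) ?_ i
      rw [← h0, h.conj_kronecker_eq_sum]
      refine Finset.sum_congr rfl fun i _ => ?_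
      simp only [conjTranspose_mul, hWh, (h.left_hermitian i).eq, Matrix.mul_assoc]
  calc V * γ i * V = (V + W) * γ i * (V + W) := by
        simp [Matrix.add_mul, Matrix.mul_add, hVγW, hWγV, hWγW]
    _ = γ i := by rw [hVW1, Matrix.one_mul, Matrix.mul_one]

/-- For a weak irreducible matrix with a symmetric Schmidt decomposition, the nonzero eigenvalues
of a leading term `γ i₀` have one sign, and the support of `γ i₀` supports every `γ i`. -/
lemma IsHermitianSchmidt.conj_support_eq_of_leading {k n : ℕ} {A : TMat k k} {c : Fin n → ℝ}
    {γ : Fin n → Matrix (Fin k) (Fin k) ℂ} (h : IsHermitianSchmidt A c γ γ)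
    (hA : IsWeakIrreducible A) {i₀ : Fin n} (hc : ∀ i, c i ≤ c i₀)
    (U : unitaryGroup (Fin k) ℂ) (a : Fin k → ℝ) (ha : γ i₀ = conjDiag U a) :
    (∀ i, conjDiag U (fun j => if a j ≠ 0 then 1 else 0) * γ i *
      conjDiag U (fun j => if a j ≠ 0 then 1 else 0) = γ i) ∧
    ∀ i j, a i ≠ 0 → a j ≠ 0 → 0 < a i * a j := by
  set P := conjDiag U a⁺ with hP
  set N := conjDiag U a⁻ with hN
  have hsub : P - N = γ i₀ := by
    rw [sub_eq_iff_eq_add, ha, hN, conjDiag_add, hP]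
    congr 1
    exact sub_eq_iff_eq_add.1 (posPart_sub_negPart a)
  have hPp : P.PosSemidef := conjDiag_posSemidef U (posPart_nonneg a)
  have hNp : N.PosSemidef := conjDiag_posSemidef U (negPart_nonneg a)
  have hPN : P * N = 0 := by
    rw [hP, hN, conjDiag_mul, ← conjDiag_zero U]
    congr 1; ext j
    rcases le_total 0 (a j) with hj | hj
    · simp [Pi.posPart_apply, Pi.negPart_apply, negPart_of_nonneg hj]
    · simp [Pi.posPart_apply, Pi.negPart_apply, posPart_of_nonpos hj]
  have hNP : N * P = 0 := by
    have := congrArg conjTranspose hPN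
    simpa [conjTranspose_mul, hPp.isHermitian.eq, hNp.isHermitian.eq] using this
  have heq₀ (Y : Matrix (Fin k) (Fin k) ℂ) :
      (A * (γ i₀ ⊗ₖ Y)).trace = c i₀ * (γ i₀ * Y).trace := by
    simp [h.trace_mul_kronecker, h.trace_mul]
  have heq₁ (Y : Matrix (Fin k) (Fin k) ℂ) :
      (A * ((P + N) ⊗ₖ Y)).trace = c i₀ * ((P + N) * Y).trace := by
    -- `P + N = |γ i₀|` has the norm of `γ i₀` because `P * N = 0`, and passing to it adds `2 (tr
    -- A(P ⊗ N) + tr A(N ⊗ P)) ≥ 0` to the form.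
    refine h.trace_mul_kronecker_of_max (h.coeff_pos i₀) hc
      (hPp.isHermitian.add hNp.isHermitian) ?_ Y
    have h1 : (P + N) * (P + N) = (P - N) * (P - N) := by
      simp [Matrix.add_mul, Matrix.mul_add, Matrix.sub_mul, Matrix.mul_sub, hPN, hNP]
    have h2 : (A * ((P + N) ⊗ₖ (P + N))).trace = (A * ((P - N) ⊗ₖ (P - N))).trace +
        2 * ((A * (P ⊗ₖ N)).trace + (A * (N ⊗ₖ P)).trace) := by
      simp only [h.trace_mul_kronecker, Matrix.mul_add, Matrix.mul_sub, trace_add, trace_sub,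
        Finset.mul_sum, ← Finset.sum_add_distrib]
      exact Finset.sum_congr rfl fun i _ => by ring
    rw [h1, h2, hsub, heq₀]
    exact le_add_of_nonneg_right (mul_nonneg zero_le_two
      (add_nonneg (trace_mul_nonneg hA.1 (hPp.kronecker hNp))
        (trace_mul_nonneg hA.1 (hNp.kronecker hPp))))
  have hadd (Y : Matrix (Fin k) (Fin k) ℂ) : (A * (P ⊗ₖ Y)).trace + (A * (N ⊗ₖ Y)).trace =
      c i₀ * ((P * Y).trace + (N * Y).trace) := by
    simpa [add_kronecker, Matrix.mul_add, Matrix.add_mul] using heq₁ Y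
  have hdiff (Y : Matrix (Fin k) (Fin k) ℂ) : (A * (P ⊗ₖ Y)).trace - (A * (N ⊗ₖ Y)).trace =
      c i₀ * ((P * Y).trace - (N * Y).trace) := by
    have hk : (P - N) ⊗ₖ Y = P ⊗ₖ Y - N ⊗ₖ Y := by
      rw [eq_sub_iff_add_eq, ← add_kronecker, sub_add_cancel]
    have := heq₀ Y
    rwa [← hsub, hk, Matrix.mul_sub, Matrix.sub_mul, trace_sub, trace_sub] at this
  -- The support of either nonzero part carries `γ i₀` itself, so it contains every index with `a j
  -- ≠ 0`; the other part must then be zero.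
  have key : ∀ f : Fin k → ℝ, 0 ≤ f → (∃ j, 0 < f j) → (∀ Y : Matrix (Fin k) (Fin k) ℂ,
      (A * (conjDiag U f ⊗ₖ Y)).trace = (c i₀ : ℂ) * (conjDiag U f * Y).trace) →
      (∀ j, a j ≠ 0 → 0 < f j) ∧
        ∀ i, conjDiag U (fun j => if 0 < f j then 1 else 0) * γ i *
          conjDiag U (fun j => if 0 < f j then 1 else 0) = γ i := by
    intro f hf hf0 heig
    have hsupp := h.conj_support_eq hA (h.coeff_pos i₀) U hf hf0 heig
    refine ⟨fun j hj => ?_, hsupp⟩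
    have := hsupp i₀
    rw [ha, conjDiag_mul, conjDiag_mul] at this
    by_contra hfj
    have h1 := congrFun (conjDiag_injective U this) j
    simp [hfj] at h1
    exact hj h1.symm
  have hne : ∃ j, a j ≠ 0 := by
    by_contra! h0
    have h1 := h.trace_mul i₀ i₀
    rw [ha, show a = 0 from funext h0, conjDiag_zero] at h1
    simp at h1
  obtain ⟨j, hj⟩ := hne
  rcases lt_or_gt_of_ne hj with hj | hj
  · obtain ⟨hpos, hsupp⟩ := key a⁻ (negPart_nonneg a) ⟨j, by simpa [Pi.negPart_apply] using hj⟩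
      fun Y => by linear_combination (hadd Y - hdiff Y) / 2
    have hlt (j) (hj : a j ≠ 0) : a j < 0 := by simpa [Pi.negPart_apply] using hpos j hj
    refine ⟨?_, fun i j hi hj => mul_pos_of_neg_of_neg (hlt i hi) (hlt j hj)⟩
    have : (fun j => if 0 < a⁻ j then (1 : ℝ) else 0) = fun j => if a j ≠ 0 then 1 else 0 := by
      ext j
      exact if_congr ⟨fun hj h0 => by simp [Pi.negPart_apply, h0] at hj, hpos j⟩ rfl rfl
    rwa [this] at hsupp
  · obtain ⟨hpos, hsupp⟩ := key a⁺ (posPart_nonneg a) ⟨j, by simpa [Pi.posPart_apply] using hj⟩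
      fun Y => by linear_combination (hadd Y + hdiff Y) / 2
    have hlt (j) (hj : a j ≠ 0) : 0 < a j := by simpa [Pi.posPart_apply] using hpos j hj
    refine ⟨?_, fun i j hi hj => mul_pos (hlt i hi) (hlt j hj)⟩
    have : (fun j => if 0 < a⁺ j then (1 : ℝ) else 0) = fun j => if a j ≠ 0 then 1 else 0 := by
      ext j
      exact if_congr ⟨fun hj h0 => by simp [Pi.posPart_apply, h0] at hj, hpos j⟩ rfl rfl
    rwa [this] at hsupp

/-! ### ### The separability criterion -/

lemma hasEigenvalue_conjDiag_kronecker {k : ℕ} (U : unitaryGroup (Fin k) ℂ) (a : Fin k → ℝ)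
    (i j : Fin k) : Module.End.HasEigenvalue
      (toLin' (conjDiag U a ⊗ₖ conjDiag U a)) ((a i * a j : ℝ) : ℂ) := by
  set p : Fin k → Matrix (Fin k) (Fin k) ℂ := fun i => conjDiag U (Pi.single i 1) with hp
  have hap (i) : conjDiag U a * p i = (a i : ℂ) • p i := by
    rw [hp, conjDiag_mul, ← conjDiag_smul]
    congr 1; ext l
    by_cases hl : l = i <;> simp [hl]
  have hM : p i ⊗ₖ p j ≠ 0 := by
    intro h0
    have := congrArg trace h0
    simp [hp, trace_kronecker, trace_conjDiag] at this
  obtain ⟨l, hl⟩ : ∃ l, (p i ⊗ₖ p j).col l ≠ 0 := by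
    by_contra! h0
    exact hM (by ext x y; exact congrFun (h0 y) x)
  refine Module.End.hasEigenvalue_of_hasEigenvector (x := (p i ⊗ₖ p j).col l)
    ⟨Module.End.mem_eigenspace_iff.2 ?_, hl⟩
  have hmul : (conjDiag U a ⊗ₖ conjDiag U a) * (p i ⊗ₖ p j) =
      ((a i * a j : ℝ) : ℂ) • (p i ⊗ₖ p j) := by
    rw [← mul_kronecker_mul, hap, hap, smul_kronecker, kronecker_smul, smul_smul,
      Complex.ofReal_mul]
  ext x
  exact congrFun (congrFun hmul x) l

/-- The condition is stated without division, so that a single-term decomposition needs no separate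
treatment. -/
theorem isSeparable_of_half_sum_le {k n : ℕ} {A : TMat k k} {c : Fin (n + 1) → ℝ}
    {γ : Fin (n + 1) → Matrix (Fin k) (Fin k) ℂ} {μ : ℝ} (hA : IsWeakIrreducible A)
    (h : IsHermitianSchmidt A c γ γ) (hc : ∀ i, c i ≤ c 0)
    (hμ : IsLeastPosEigenvalue (γ 0 ⊗ₖ γ 0) μ) (hle : 1 / 2 * ∑ i : Fin n, c i.succ ≤ c 0 * μ) :
    IsSeparable A := by
  obtain ⟨U, a, ha⟩ := (h.left_hermitian 0).exists_eq_conjDiag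
  obtain ⟨hsupp, hsign⟩ := h.conj_support_eq_of_leading hA hc U a ha
  set g : Fin k → ℝ := fun j => if a j ≠ 0 then 1 else 0 with hg
  set V := conjDiag U g with hV
  have hVh : Vᴴ = V := conjDiag_isHermitian U _
  have hVV : V * V = V := (conjDiag_indicator_isStarProjection U _).isIdempotentElem
  have hVp : V.PosSemidef := conjDiag_posSemidef U fun i => by simp only [hg]; split_ifs <;> simp
  have hlead : IsSeparable (γ 0 ⊗ₖ γ 0 + ((-μ : ℝ) : ℂ) • (V ⊗ₖ V)) := by
    rw [ha, hV]
    refine isSeparable_conjDiag_kronecker_add U a g _ fun i j => ?_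
    by_cases hi : a i = 0
    · simp [hg, hi]
    by_cases hj : a j = 0
    · simp [hg, hj]
    have := hμ.2 ⟨hsign i j hi hj, by rw [ha]; exact hasEigenvalue_conjDiag_kronecker U a i j⟩
    simpa [hg, hi, hj] using this
  have hterm (i) : IsSeparable (γ i ⊗ₖ γ i + ((1 / 2 : ℝ) : ℂ) • (V ⊗ₖ V)) := by
    -- Compressing by `V ⊗ V` fixes `γ i ⊗ γ i` and turns the identity into `V ⊗ V`.
    have h1 := (isSeparable_kronecker_self_add_half (h.left_hermitian i)
      (by simp [h.trace_mul])).conj_kronecker V V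
    rw [hVh, Matrix.mul_add, Matrix.add_mul, Matrix.mul_smul, Matrix.smul_mul] at h1
    simp only [← mul_kronecker_mul] at h1
    rwa [Matrix.mul_one, hVV, hsupp i] at h1
  -- The copies of `V ⊗ V` cancel; the last coefficient is the slack in the hypothesis.
  have hdec : A = (c 0 : ℂ) • (γ 0 ⊗ₖ γ 0 + ((-μ : ℝ) : ℂ) • (V ⊗ₖ V)) +
      (∑ i : Fin n, (c i.succ : ℂ) • (γ i.succ ⊗ₖ γ i.succ + ((1 / 2 : ℝ) : ℂ) • (V ⊗ₖ V)) +
      ((c 0 * μ - 1 / 2 * ∑ i : Fin n, c i.succ : ℝ) : ℂ) • (V ⊗ₖ V)) := by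
    rw [h.eq_sum, Fin.sum_univ_succ]
    simp only [smul_add, Finset.sum_add_distrib, smul_smul, ← Finset.sum_smul, ← Finset.sum_mul]
    push_cast
    module
  rw [hdec]
  exact (hlead.smul (h.coeff_pos 0).le).add
    ((isSeparable_sum _ fun i _ => (hterm i.succ).smul (h.coeff_pos _).le).add
      ((isSeparable_kronecker hVp hVp).smul (sub_nonneg.2 hle)))

/-! ### The Pauli basis -/

lemma normalizedPauli_isHermitian (i : Fin 4) : (normalizedPauli i).IsHermitian := by
  ext a b
  fin_cases i <;> fin_cases a <;> fin_cases b <;> simp [normalizedPauli]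

lemma normalizedPauli_trace_mul (i j : Fin 4) :
    (normalizedPauli i * normalizedPauli j).trace = if i = j then 1 else 0 := by
  have h : ((Real.sqrt 2 : ℝ) : ℂ)⁻¹ * ((Real.sqrt 2 : ℝ) : ℂ)⁻¹ = 1 / 2 := by
    rw [← mul_inv, ← Complex.ofReal_mul, Real.mul_self_sqrt zero_le_two]
    simp
  have hI : ((Real.sqrt 2 : ℝ) : ℂ)⁻¹ * Complex.I * (((Real.sqrt 2 : ℝ) : ℂ)⁻¹ * Complex.I) =
      -(1 / 2) := by
    rw [mul_mul_mul_comm, h, Complex.I_mul_I, mul_neg_one]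
  fin_cases i <;> fin_cases j <;>
    simp [normalizedPauli, trace_fin_two, h, hI] <;> norm_num

lemma normalizedPauli_zero_kronecker :
    normalizedPauli 0 ⊗ₖ normalizedPauli 0 = ((1 / 2 : ℝ) : ℂ) • (1 : TMat 2 2) := by
  have h : ((Real.sqrt 2 : ℝ) : ℂ)⁻¹ * ((Real.sqrt 2 : ℝ) : ℂ)⁻¹ = ((1 / 2 : ℝ) : ℂ) := by
    rw [← mul_inv, ← Complex.ofReal_mul, Real.mul_self_sqrt zero_le_two]
    simp
  have h0 : normalizedPauli 0 = ((Real.sqrt 2 : ℝ) : ℂ)⁻¹ • (1 : Matrix (Fin 2) (Fin 2) ℂ) := by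
    simp [normalizedPauli, one_fin_two]
  rw [h0, smul_kronecker, kronecker_smul, smul_smul, h, one_kronecker_one]

lemma isLeastPosEigenvalue_normalizedPauli_zero :
    IsLeastPosEigenvalue (normalizedPauli 0 ⊗ₖ normalizedPauli 0) (1 / 2) := by
  have hlin : toLin' (normalizedPauli 0 ⊗ₖ normalizedPauli 0) =
      ((1 / 2 : ℝ) : ℂ) • (LinearMap.id : (Fin 2 × Fin 2 → ℂ) →ₗ[ℂ] _) := by
    rw [normalizedPauli_zero_kronecker, map_smul, toLin'_one]
  refine ⟨⟨by norm_num, ?_⟩, fun x hx => ?_⟩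
  · refine Module.End.hasEigenvalue_of_hasEigenvector (x := fun _ => 1)
      ⟨Module.End.mem_eigenspace_iff.2 (by rw [hlin]; rfl), fun h => ?_⟩
    exact one_ne_zero (congrFun h (0, 0))
  · obtain ⟨v, hv⟩ := hx.2.exists_hasEigenvector
    have h1 := hv.apply_eq_smul
    rw [hlin, LinearMap.smul_apply, LinearMap.id_apply] at h1
    exact (Complex.ofReal_injective (smul_left_injective ℂ hv.2 h1)).le

lemma isHermitianSchmidt_pauliMatrix {c : Fin 4 → ℝ} (hc : ∀ i, 0 < c i) :
    IsHermitianSchmidt (pauliMatrix c) c normalizedPauli normalizedPauli := by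
  have h : IsOrthonormalFamily normalizedPauli := fun i j => by
    rw [normalizedPauli_isHermitian j, normalizedPauli_trace_mul]
  exact ⟨hc, normalizedPauli_isHermitian, normalizedPauli_isHermitian, h, h, rfl⟩

lemma trace_contract_pauliMatrix (c : Fin 4 → ℝ) :
    (contract (pauliMatrix c)).trace = ((c 0 + c 1 + c 2 + c 3 : ℝ) : ℂ) := by
  simp [pauliMatrix, contract_kronecker, normalizedPauli_trace_mul, Fin.sum_univ_four]

lemma trace_pauliMatrix (c : Fin 4 → ℝ) : (pauliMatrix c).trace = ((2 * c 0 : ℝ) : ℂ) := by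
  have h : ∀ i : Fin 3, (normalizedPauli i.succ).trace = 0 := by
    intro i
    fin_cases i <;> simp [normalizedPauli, trace_fin_two]
  rw [pauliMatrix, Fin.sum_univ_succ, normalizedPauli_zero_kronecker]
  simp [trace_add, trace_sum, trace_smul, trace_kronecker, h]
  ring

/-- The trace of `contract A` is the pairing of `A` with the swap operator; on `C ⊗ D` the claim
reads `tr (C * D) ≤ tr C * tr D`. -/
lemma IsSeparable.trace_contract_le {k : ℕ} {A : TMat k k} (h : IsSeparable A) :
    (contract A).trace ≤ A.trace := by
  obtain ⟨n, C, D, hC, hD, rfl⟩ := h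
  simp only [map_sum, contract_kronecker, trace_sum, trace_kronecker]
  exact Finset.sum_le_sum fun i _ => trace_mul_le_trace_mul_trace (hC i) (hD i)

lemma isSeparable_pauliMatrix_iff {c : Fin 4 → ℝ} (hc : ∀ i, 0 < c i) :
    IsSeparable (pauliMatrix c) ↔ c 1 + c 2 + c 3 ≤ c 0 := by
  constructor
  · intro h
    have := h.trace_contract_le
    rw [trace_contract_pauliMatrix, trace_pauliMatrix, Complex.real_le_real] at this
    linarith
  · intro h
    -- Here `γ 0 ⊗ γ 0` is half the identity, so it pays directly for the three other terms.
    have hdec : pauliMatrix c = ∑ i : Fin 3, (c i.succ : ℂ) •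
        (normalizedPauli i.succ ⊗ₖ normalizedPauli i.succ + ((1 / 2 : ℝ) : ℂ) • (1 ⊗ₖ 1)) +
        ((1 / 2 * (c 0 - (c 1 + c 2 + c 3)) : ℝ) : ℂ) • (1 ⊗ₖ 1) := by
      rw [pauliMatrix, Fin.sum_univ_succ, normalizedPauli_zero_kronecker, one_kronecker_one]
      have h3 : ∑ i : Fin 3, (c i.succ : ℂ) = c 1 + c 2 + c 3 := Fin.sum_univ_three _
      simp only [smul_add, Finset.sum_add_distrib, smul_smul, ← Finset.sum_smul,
        ← Finset.sum_mul, h3]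
      push_cast
      module
    rw [hdec]
    exact (isSeparable_sum _ fun i _ => (isSeparable_kronecker_self_add_half
      (normalizedPauli_isHermitian _) (by simp [normalizedPauli_trace_mul])).smul (hc _).le).add
      ((isSeparable_kronecker PosSemidef.one PosSemidef.one).smul (by linarith))

end Bipartite

theorem mainTheorem8 :
    (∀ (k n : ℕ) (A : Bipartite.TMat k k) (c : Fin (n + 1) → ℝ)
        (γ : Fin (n + 1) → Matrix (Fin k) (Fin k) ℂ) (μ : ℝ),
      Bipartite.IsSPC A → Bipartite.IsWeakIrreducible A →
      Bipartite.IsHermitianSchmidt A c γ γ → Antitone c →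
      Bipartite.IsLeastPosEigenvalue (γ 0 ⊗ₖ γ 0) μ →
      -- for one term (`n = 0`) there is nothing to divide by and the condition is void
      (n = 0 ∨ 1 / 2 ≤ c 0 * μ / ∑ i : Fin n, c i.succ) →
      Bipartite.IsSeparable A) ∧
    (Bipartite.IsLeastPosEigenvalue
        (Bipartite.normalizedPauli 0 ⊗ₖ Bipartite.normalizedPauli 0) (1 / 2) ∧
      ∀ c : Fin 4 → ℝ, (∀ i, 0 < c i) →
        Bipartite.IsHermitianSchmidt (Bipartite.pauliMatrix c) c
          Bipartite.normalizedPauli Bipartite.normalizedPauli ∧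
        (Bipartite.IsSeparable (Bipartite.pauliMatrix c) ↔
          1 / 2 ≤ c 0 * (1 / 2) / (c 1 + c 2 + c 3))) := by
  refine ⟨fun k n A c γ μ _ hA h hc hμ hle => ?_,
    Bipartite.isLeastPosEigenvalue_normalizedPauli_zero, fun c hc => ⟨
      Bipartite.isHermitianSchmidt_pauliMatrix hc, ?_⟩⟩
  · refine Bipartite.isSeparable_of_half_sum_le hA h (fun i => hc (Fin.zero_le i)) hμ ?_
    have hpos : 0 < c 0 * μ := mul_pos (h.coeff_pos 0) hμ.1.1
    rcases hle with rfl | hle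
    · rw [Fin.sum_univ_zero, mul_zero]
      exact hpos.le
    -- Clearing the denominator needs a positive tail sum; if that sum is zero, `hpos` suffices.
    · rcases (Finset.sum_nonneg fun (i : Fin n) _ => (h.coeff_pos i.succ).le).eq_or_lt with h0 | h0
      · rw [← h0, mul_zero]
        exact hpos.le
      · exact (le_div_iff₀ h0).1 hle
  · have hS : 0 < c 1 + c 2 + c 3 := add_pos (add_pos (hc 1) (hc 2)) (hc 3)
    rw [Bipartite.isSeparable_pauliMatrix_iff hc, le_div_iff₀ hS]
    constructor <;> intro h <;> linarith
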